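/- Let $I=[0,1]$, let $W:I^2\to[0,1]$ be a symmetric measurable function that is continuous at almost every point of $I^2$, let $D:\mathbb R\to\mathbb R$ be Lipschitz continuous, and let $g:I\to\mathbb R$ be a bounded measurable function that is continuous at almost every point of $I$. Let $\mathbf u\in C^1(\mathbb R;L^\infty(I))$, $\mathbf u(t)=u(\cdot,t)$, be the strong solution of $$\frac{\partial}{\partial t}u(x,t)=\int_I W(x,y)\,D\big(u(y,t)-u(x,t)\big)\,dy,\qquad u(x,0)=g(x).$$ Let $T>0$ and suppose that $$\min_{t\in[0,T]}\int_{I^2} D\big(u(y,t)-u(x,t)\big)^2\,W(x,y)\big(1-W(x,y)\big)\,dx\,dy>0 .$$ For $n\ge 1$ put $I_{ni}=[(i-1)/n,i/n)$ for $1\le i\le n-1$ and $I_{nn}=[(n-1)/n,1]$, and let $x_{ni}\in\overline{I_{ni}}$, $1\le i\le n$, be arbitrary deterministic points. Let $G_n=\mathbb G(W,X_n)$ be the $W$-random graph generated by $X_n=\{x_{n1},\dots,x_{nn}\}$: its node set is $[n]=\{1,\dots,n\}$, it has no loops, each pair $(i,j)\in[n]^2$, $i\ne j$, is an edge with probability $W(x_{ni},x_{nj})$,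 and the decisions for different pairs are independent (the pairs may be taken ordered, or unordered with $G_n$ undirected; the assertion is made in both cases). Let $u_n(t)=(u_{n1}(t),\dots,u_{nn}(t))$, $t\in\mathbb R$, be the solution of $$\frac{d}{dt}u_{ni}(t)=\frac1n\sum_{j:(i,j)\in E(G_n)}D\big(u_{nj}(t)-u_{ni}(t)\big),\qquad u_{ni}(0)=g(x_{ni}),\qquad i\in[n],$$ and put $u_n(x,t)=u_{ni}(t)$ for $x\in I_{ni}$, $\mathbf u_n(t)=u_n(\cdot,t)$. Then $$\|\mathbf u_n-\mathbf u\|_{C(0,T;L^2(I))}=\sup_{t\in[0,T]}\|\mathbf u_n(t)-\mathbf u(t)\|_{L^2(I)}\longrightarrow 0\quad\text{in probability as } n\to\infty .$$ -/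

import Mathlib

open MeasureTheory ProbabilityTheory Filter Topology
open scoped ENNReal unitInterval

noncomputable section

namespace GraphonHeat

/-- The class `𝒲₀`: symmetric (Lebesgue) measurable functions on `I²`, `I = [0,1]`, with values
in `[0,1]`. Lebesgue measurability is `AEMeasurable` with respect to Lebesgue measure on `I²`. -/
structure IsGraphon (W : I → I → ℝ) : Prop where
  symm : ∀ x y, W x y = W y x
  measurable : AEMeasurable (fun p : I × I => W p.1 p.2) volume
  nonneg : ∀ x y, 0 ≤ W x y
  le_one : ∀ x y, W x y ≤ 1

/-- The cells of the uniform partition of `I` into `n` intervals, with `i` counted from `0`: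
`[i/n, (i+1)/n)` for `i + 1 < n`, and `[(n-1)/n, 1]` for the last one. -/
def cell (n : ℕ) (i : Fin n) : Set I :=
  {x | (i : ℝ) / n ≤ (x : ℝ) ∧ ((x : ℝ) < ((i : ℝ) + 1) / n ∨ (i : ℕ) + 1 = n)}

/-- The step function on `I` that takes the value `v i` on the `i`-th cell. -/
def stepFun {n : ℕ} (v : Fin n → ℝ) (x : I) : ℝ :=
  ∑ i : Fin n, (cell n i).indicator (fun _ => v i) x

/-- `G` is a random graph on `n` nodes with the law `𝔾(W, X)`, `X = (x 0, …, x (n-1))`: there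
are no loops, and for `i ≠ j` the pair `(i, j)` is an edge with probability `W (x i) (x j)`,
independently for different pairs. Graphs are given by their (possibly asymmetric) adjacency
relation. Both readings of "pair" are admitted: independent decisions for all ordered pairs
`(i, j)`, `i ≠ j`, or an undirected graph with independent decisions for all unordered pairs. -/
structure IsWRandomGraph {Ω : Type*} [MeasurableSpace Ω] (P : Measure Ω) (W : I → I → ℝ)
    {n : ℕ} (x : Fin n → I) (G : Ω → Digraph (Fin n)) : Prop where
  loopless : ∀ ω i, ¬ (G ω).Adj i i
  measurableSet_adj : ∀ i j, MeasurableSet {ω | (G ω).Adj i j}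
  prob_adj : ∀ i j, i ≠ j → P {ω | (G ω).Adj i j} = ENNReal.ofReal (W (x i) (x j))
  indep :
    iIndepSet (fun p : {p : Fin n × Fin n // p.1 ≠ p.2} =>
      {ω | (G ω).Adj p.1.1 p.1.2}) P ∨
    ((∀ ω i j, (G ω).Adj i j → (G ω).Adj j i) ∧
      iIndepSet (fun p : {p : Fin n × Fin n // p.1 < p.2} =>
        {ω | (G ω).Adj p.1.1 p.1.2}) P)

open Classical in
/-- `v : ℝ → ℝⁿ` solves the initial value problem for the nonlinear heat equation on the graph
`G`: `v_i' = n⁻¹ ∑_{j : (i,j) ∈ E(G)} D (v_j - v_i)` on `ℝ`, and `v_i(0) = g (x_i)`. -/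
structure IsDiscreteSolution (D : ℝ → ℝ) (g : I → ℝ) {n : ℕ} (x : Fin n → I)
    (G : Digraph (Fin n)) (v : ℝ → Fin n → ℝ) : Prop where
  init : ∀ i, v 0 i = g (x i)
  hasDerivAt : ∀ t i, HasDerivAt (fun s => v s i)
    ((n : ℝ)⁻¹ * ∑ j ∈ Finset.univ.filter (fun j => G.Adj i j), D (v t j - v t i)) t

/-- `u ∈ C¹(ℝ; L^∞(I))` is the strong solution of the continuum initial value problem
`∂ₜ u(x,t) = ∫_I W(x,y) D (u(y,t) - u(x,t)) dy`, `u(x,0) = g(x)`. -/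
structure IsContinuumSolution (W : I → I → ℝ) (D : ℝ → ℝ) (g : I → ℝ)
    (u : ℝ → Lp ℝ ∞ (volume : Measure I)) : Prop where
  contDiff : ContDiff ℝ 1 u
  init : u 0 =ᵐ[volume] g
  deriv_eq : ∀ t, ((deriv u t : Lp ℝ ∞ (volume : Measure I)) : I → ℝ) =ᵐ[volume]
    fun x => ∫ y : I, W x y * D (u t y - u t x)

/-- The norm of `C(0,T; L²(I))`: `sup_{t ∈ [0,T]} ‖f(·,t)‖_{L²(I)}`, as an extended
nonnegative number. -/
def normCL2 (T : ℝ) (f : ℝ → I → ℝ) : ℝ≥0∞ :=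
  ⨆ t ∈ Set.Icc (0 : ℝ) T, eLpNorm (f t) 2 (volume : Measure I)

end GraphonHeat

end

namespace GraphonHeat

/-! The proof is a Gronwall argument in `L²(I)` for the error e(t) = u_n(t) - u(t). The derivative
of e splits into three terms: a Lipschitz term bounded by a multiple of the norm of e, the effect of
replacing `W` by its sampled step kernel, and a noise term, namely the nonlocal operator with kernel
adjacency minus `W`, evaluated along u(t) (`abs_velocity_sub_le`, `normCL2_le`).

Evaluating the noise along u, which is deterministic, rather than along u_n decouples it from the
graph. At a fixed time the entries in one row of the centred adjacency matrix are uncorrelated and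
each weight is O(1/n), so the second moment of the noise is O(1/n), and Markov's inequality applies
(`IsWRandomGraph.measure_le_eLpNorm_nonlocalOp`).

To control all t in [0,T] at once, the noise operator is Lipschitz in the state for the supremum
norm, uniformly over graphs (`eLpNorm_nonlocalOp_le`). Since u is continuous into `L^∞`, a finite
net of times and a union bound suffice. The kernel and initial errors are deterministic and vanish
by almost everywhere continuity and dominated convergence. -/

/-- The index of the cell of the uniform partition of `I` into `n` intervals that contains `x`. -/
noncomputable def cellIdx (n : ℕ) [NeZero n] (x : I) : Fin n :=
  ⟨min ⌊(n : ℝ) * x⌋₊ (n - 1), by have := NeZero.pos n; omega⟩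

/-! ### The uniform partition and step functions. -/

section Cells

variable {n : ℕ} [NeZero n]

/-- The `min` in `cellIdx` matters only at x = 1, where the floor is n; it matches the right-closed
last cell. -/
theorem mem_cell_iff (i : Fin n) (x : I) : x ∈ cell n i ↔ cellIdx n x = i := by
  have hn : 0 < n := NeZero.pos n
  have hn' : (0 : ℝ) < n := by exact_mod_cast hn
  have hx0 : 0 ≤ (n : ℝ) * x := mul_nonneg hn'.le x.2.1
  have hx1 : (n : ℝ) * x ≤ n := by nlinarith [x.2.2]
  have hi := i.2
  have hfl : ⌊(n : ℝ) * x⌋₊ ≤ n := Nat.floor_le_of_le hx1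
  rw [Fin.ext_iff]
  simp only [cell, cellIdx, Set.mem_ofPred_eq]
  rw [div_le_iff₀ hn', lt_div_iff₀ hn', mul_comm (x : ℝ), ← Nat.le_floor_iff hx0]
  have : (n : ℝ) * x < i + 1 ↔ ⌊(n : ℝ) * x⌋₊ < (i : ℕ) + 1 := by
    rw [Nat.floor_lt hx0]; push_cast; rfl
  rw [this]
  omega

theorem mem_cell_cellIdx (x : I) : x ∈ cell n (cellIdx n x) :=
  (mem_cell_iff _ _).2 rfl

theorem stepFun_apply (v : Fin n → ℝ) (x : I) : stepFun v x = v (cellIdx n x) := by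
  unfold stepFun
  rw [Finset.sum_eq_single (cellIdx n x)]
  · rw [Set.indicator_of_mem (mem_cell_cellIdx x)]
  · intro i _ hi
    exact Set.indicator_of_notMem (fun h => hi ((mem_cell_iff i x).1 h).symm) _
  · simp

theorem measurable_cellIdx : Measurable (cellIdx n) := by
  refine measurable_to_countable' fun i => ?_
  have : cellIdx n ⁻¹' {i} = cell n i := by
    ext x; simp [mem_cell_iff]
  rw [this]
  have h1 : MeasurableSet {x : I | (i : ℝ) / n ≤ (x : ℝ)} :=
    measurableSet_le measurable_const measurable_subtype_coe
  have h2 : MeasurableSet {x : I | (x : ℝ) < ((i : ℝ) + 1) / n} :=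
    measurableSet_lt measurable_subtype_coe measurable_const
  exact h1.inter (h2.union (MeasurableSet.const _))

theorem volume_cell (i : Fin n) : (volume : Measure I) (cell n i) = ENNReal.ofReal (n : ℝ)⁻¹ := by
  have hn : 0 < n := NeZero.pos n
  have hn' : (0 : ℝ) < n := by exact_mod_cast hn
  have hi : (i : ℝ) + 1 ≤ n := by exact_mod_cast i.2
  have hi0 : (0 : ℝ) ≤ i := by positivity
  let a : I := ⟨(i : ℝ) / n, by positivity, by rw [div_le_one hn']; linarith⟩
  let b : I := ⟨((i : ℝ) + 1) / n, by positivity, by rw [div_le_one hn']; linarith⟩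
  by_cases h : (i : ℕ) + 1 = n
  · have hc : cell n i = Set.Ici a := by
      ext x; simp [cell, h, a, ← Subtype.coe_le_coe]
    rw [hc, unitInterval.volume_Ici]
    congr 1
    have h' : (i : ℝ) + 1 = n := by exact_mod_cast h
    simp only [a]
    field_simp
    linarith
  · have hc : cell n i = Set.Ico a b := by
      ext x; simp [cell, h, a, b, ← Subtype.coe_le_coe, ← Subtype.coe_lt_coe]
    rw [hc, unitInterval.volume_Ico]
    congr 1
    simp only [a, b]
    field_simp
    ring

theorem measureReal_cell (i : Fin n) : (volume : Measure I).real (cell n i) = (n : ℝ)⁻¹ := by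
  rw [Measure.real, volume_cell, ENNReal.toReal_ofReal (by positivity)]

theorem measurableSet_cell (i : Fin n) : MeasurableSet (cell n i) := by
  have : cell n i = cellIdx n ⁻¹' {i} := by
    ext x; simp [mem_cell_iff]
  rw [this]
  exact measurable_cellIdx (measurableSet_singleton i)

theorem integral_comp_cellIdx (h : Fin n → ℝ) :
    ∫ y : I, h (cellIdx n y) = (n : ℝ)⁻¹ * ∑ j, h j := by
  have : (fun y : I => h (cellIdx n y)) = fun y => ∑ j, (cell n j).indicator (fun _ => h j) y := by
    ext y; exact (stepFun_apply h y).symm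
  rw [this, integral_finsetSum _ fun j _ => (integrable_const _).indicator (measurableSet_cell j),
    Finset.mul_sum]
  refine Finset.sum_congr rfl fun j _ => ?_
  rw [integral_indicator_const _ (measurableSet_cell j), measureReal_cell, smul_eq_mul]

theorem dist_le_of_mem_closure_cell {x y : I} {i : Fin n} (hx : x ∈ closure (cell n i))
    (hy : y ∈ cell n i) : dist x y ≤ (n : ℝ)⁻¹ := by
  have hn : 0 < n := NeZero.pos n
  have hn' : (0 : ℝ) < n := by exact_mod_cast hn
  have key : cell n i ⊆ {x : I | (i : ℝ) / n ≤ x ∧ (x : ℝ) ≤ ((i : ℝ) + 1) / n} := by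
    rintro z ⟨h1, h2⟩
    refine ⟨h1, ?_⟩
    rcases h2 with h2 | h2
    · exact h2.le
    · have h' : (i : ℝ) + 1 = n := by exact_mod_cast h2
      rw [h', div_self hn'.ne']
      exact z.2.2
  have hcl : IsClosed {x : I | (i : ℝ) / n ≤ x ∧ (x : ℝ) ≤ ((i : ℝ) + 1) / n} :=
    (isClosed_le continuous_const continuous_subtype_val).inter
      (isClosed_le continuous_subtype_val continuous_const)
  obtain ⟨a1, a2⟩ := closure_minimal key hcl hx
  obtain ⟨b1, b2⟩ := key hy
  have : ((i : ℝ) + 1) / n = i / n + (n : ℝ)⁻¹ := by rw [add_div, one_div]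
  rw [Subtype.dist_eq, Real.dist_eq, abs_le]
  constructor <;> linarith

end Cells

/-- Sample points in the closed cells converge to the point whose cell they sample. -/
theorem tendsto_sample {x : (n : ℕ) → Fin n → I} (hx : ∀ n i, x n i ∈ closure (cell n i)) (y : I) :
    Tendsto (fun n : ℕ => x (n + 1) (cellIdx (n + 1) y)) atTop (𝓝 y) := by
  rw [tendsto_iff_dist_tendsto_zero]
  refine squeeze_zero (fun _ => dist_nonneg)
    (fun n => dist_le_of_mem_closure_cell (hx _ _) (mem_cell_cellIdx y)) ?_
  have := tendsto_one_div_add_atTop_nhds_zero_nat (𝕜 := ℝ)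
  simpa using this

/-! ### Second moments of the centred adjacency matrix. -/

section Noise

open Classical in
/-- The adjacency matrix of a digraph. -/
noncomputable def adj {n : ℕ} (G : Digraph (Fin n)) (i j : Fin n) : ℝ := if G.Adj i j then 1 else 0

theorem adj_eq_indicator {Ω : Type*} {n : ℕ} (G : Ω → Digraph (Fin n)) (i j : Fin n) :
    (fun ω => adj (G ω) i j) = {ω | (G ω).Adj i j}.indicator 1 := by
  ext ω; by_cases h : (G ω).Adj i j <;> simp [adj, h]

variable {Ω : Type*} [MeasurableSpace Ω] {P : Measure Ω} {W : I → I → ℝ} {n : ℕ} {x : Fin n → I}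
  {G : Ω → Digraph (Fin n)}

theorem adj_nonneg (G : Digraph (Fin n)) (i j : Fin n) : 0 ≤ adj G i j := by
  unfold adj; split_ifs <;> norm_num

theorem adj_le_one (G : Digraph (Fin n)) (i j : Fin n) : adj G i j ≤ 1 := by
  unfold adj; split_ifs <;> norm_num

theorem IsWRandomGraph.measurable_adj (hG : IsWRandomGraph P W x G) (i j : Fin n) :
    Measurable fun ω => adj (G ω) i j := by
  rw [adj_eq_indicator]
  exact measurable_one.indicator (hG.measurableSet_adj i j)

theorem _root_.ProbabilityTheory.iIndepSet.measure_inter {ι : Type*} {s : ι → Set Ω}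
    (h : iIndepSet s P) {a b : ι} (hab : a ≠ b) : P (s a ∩ s b) = P (s a) * P (s b) := by
  classical
  have := h.meas_biInter {a, b}
  simpa [Finset.prod_pair hab] using this

/-- Only pairs within one row are compared. For j ≠ k the unordered pairs {i,j} and {i,k} also
differ, so both readings of "pair" give independence; a diagonal event is empty. -/
theorem IsWRandomGraph.measure_inter (hG : IsWRandomGraph P W x G) {i j k : Fin n} (hjk : j ≠ k) :
    P ({ω | (G ω).Adj i j} ∩ {ω | (G ω).Adj i k}) =
      P {ω | (G ω).Adj i j} * P {ω | (G ω).Adj i k} := by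
  by_cases hij : i = j
  · subst hij; simp [hG.loopless]
  by_cases hik : i = k
  · subst hik; simp [hG.loopless]
  rcases hG.indep with h | ⟨hs, h⟩
  · exact h.measure_inter (a := ⟨(i, j), hij⟩) (b := ⟨(i, k), hik⟩) (by simp [hjk])
  · have key : ∀ l, i ≠ l → ∃ p : {p : Fin n × Fin n // p.1 < p.2},
        {ω | (G ω).Adj i l} = {ω | (G ω).Adj p.1.1 p.1.2} ∧ (p.1 = (i, l) ∨ p.1 = (l, i)) := by
      intro l hl
      rcases lt_or_gt_of_ne hl with h' | h'
      · exact ⟨⟨(i, l), h'⟩, rfl, Or.inl rfl⟩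
      · refine ⟨⟨(l, i), h'⟩, ?_, Or.inr rfl⟩
        ext ω; exact ⟨hs _ _ _, hs _ _ _⟩
    obtain ⟨p, hp, hp'⟩ := key j hij
    obtain ⟨q, hq, hq'⟩ := key k hik
    rw [hp, hq]
    refine h.measure_inter (a := p) (b := q) ?_
    rintro rfl
    grind

/-- The centred adjacency matrix of a `W`-random graph. -/
noncomputable def centredAdj (W : I → I → ℝ) {n : ℕ} (x : Fin n → I) (G : Digraph (Fin n))
    (i j : Fin n) : ℝ :=
  adj G i j - W (x i) (x j)

theorem abs_centredAdj_le (hW : IsGraphon W) (G : Digraph (Fin n)) (i j : Fin n) :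
    |centredAdj W x G i j| ≤ 1 := by
  have := adj_nonneg G i j
  have := adj_le_one G i j
  have := hW.nonneg (x i) (x j)
  have := hW.le_one (x i) (x j)
  rw [centredAdj, abs_le]; constructor <;> linarith

theorem IsWRandomGraph.measurable_centredAdj (hG : IsWRandomGraph P W x G) (i j : Fin n) :
    Measurable fun ω => centredAdj W x (G ω) i j :=
  (hG.measurable_adj i j).sub_const _

variable [IsProbabilityMeasure P]

/-- By independence the expectation factors as (P A - W_ij)(P B - W_ik). A diagonal entry is not
centred, but at most one of j, k equals i, so one factor always vanishes. -/
theorem IsWRandomGraph.integral_centredAdj_mul (hW : IsGraphon W) (hG : IsWRandomGraph P W x G)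
    {i j k : Fin n} (hjk : j ≠ k) :
    ∫ ω, centredAdj W x (G ω) i j * centredAdj W x (G ω) i k ∂P = 0 := by
  set A := {ω | (G ω).Adj i j}
  set B := {ω | (G ω).Adj i k}
  have hA : MeasurableSet A := hG.measurableSet_adj i j
  have hB : MeasurableSet B := hG.measurableSet_adj i k
  have e : (fun ω => centredAdj W x (G ω) i j * centredAdj W x (G ω) i k) = fun ω =>
      (A ∩ B).indicator (fun _ => (1 : ℝ)) ω - A.indicator (fun _ => W (x i) (x k)) ω
        - B.indicator (fun _ => W (x i) (x j)) ω + W (x i) (x j) * W (x i) (x k) := by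
    ext ω
    by_cases h1 : (G ω).Adj i j <;> by_cases h2 : (G ω).Adj i k <;>
      simp [centredAdj, adj, A, B, h1, h2] <;> ring
  have i1 : Integrable ((A ∩ B).indicator (fun _ => (1 : ℝ))) P :=
    (integrable_const _).indicator (hA.inter hB)
  have i2 : Integrable (A.indicator (fun _ => W (x i) (x k))) P := (integrable_const _).indicator hA
  have i3 : Integrable (B.indicator (fun _ => W (x i) (x j))) P := (integrable_const _).indicator hB
  have i12 : Integrable (fun ω => (A ∩ B).indicator (fun _ => (1 : ℝ)) ω -
      A.indicator (fun _ => W (x i) (x k)) ω) P := i1.sub i2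
  have i123 : Integrable (fun ω => (A ∩ B).indicator (fun _ => (1 : ℝ)) ω -
      A.indicator (fun _ => W (x i) (x k)) ω - B.indicator (fun _ => W (x i) (x j)) ω) P :=
    i12.sub i3
  rw [e, integral_add i123 (integrable_const _), integral_sub i12 i3,
    integral_sub i1 i2, integral_indicator_const _ (hA.inter hB), integral_indicator_const _ hA,
    integral_indicator_const _ hB]
  have hAB : P.real (A ∩ B) = P.real A * P.real B := by
    simp only [Measure.real, A, B, hG.measure_inter hjk, ENNReal.toReal_mul]
  have hreal : ∀ l, i ≠ l → P.real {ω | (G ω).Adj i l} = W (x i) (x l) := fun l hl => by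
    rw [Measure.real, hG.prob_adj i l hl, ENNReal.toReal_ofReal (hW.nonneg _ _)]
  have hz : P.real A = W (x i) (x j) ∨ P.real B = W (x i) (x k) := by
    by_cases h : i = j
    · exact Or.inr (hreal k (h ▸ hjk))
    · exact Or.inl (hreal j h)
  have : (P.real A - W (x i) (x j)) * (P.real B - W (x i) (x k)) = 0 := by
    rcases hz with h | h <;> simp [h]
  simp only [hAB, smul_eq_mul, integral_const, probReal_univ]
  linarith

theorem IsWRandomGraph.integrable_centredAdj_mul (hW : IsGraphon W) (hG : IsWRandomGraph P W x G)
    (i j k : Fin n) :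
    Integrable (fun ω => centredAdj W x (G ω) i j * centredAdj W x (G ω) i k) P := by
  refine Integrable.of_bound
    ((hG.measurable_centredAdj i j).mul (hG.measurable_centredAdj i k)).aestronglyMeasurable 1
    (ae_of_all _ fun ω => ?_)
  rw [Real.norm_eq_abs, abs_mul]
  exact mul_le_one₀ (abs_centredAdj_le hW _ _ _) (abs_nonneg _) (abs_centredAdj_le hW _ _ _)

/-- The second moment of a linear combination of a row of the centred adjacency matrix. -/
theorem IsWRandomGraph.integral_sq_sum_le (hW : IsGraphon W) (hG : IsWRandomGraph P W x G)
    (i : Fin n) (a : Fin n → ℝ) :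
    ∫ ω, (∑ j, centredAdj W x (G ω) i j * a j) ^ 2 ∂P ≤ ∑ j, a j ^ 2 := by
  have e : (fun ω => (∑ j, centredAdj W x (G ω) i j * a j) ^ 2) = fun ω =>
      ∑ j, ∑ k, (centredAdj W x (G ω) i j * centredAdj W x (G ω) i k) * (a j * a k) := by
    ext ω
    rw [sq, Finset.sum_mul_sum]
    exact Finset.sum_congr rfl fun j _ => Finset.sum_congr rfl fun k _ => by ring
  have hint := hG.integrable_centredAdj_mul hW i
  rw [e, integral_finsetSum _ fun j _ => integrable_finsetSum _ fun k _ => (hint j k).mul_const _]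
  -- Only the diagonal k = j survives, and there the squared entry is at most 1.
  refine Finset.sum_le_sum fun j _ => ?_
  rw [integral_finsetSum _ fun k _ => (hint j k).mul_const _, Finset.sum_eq_single j]
  · rw [integral_mul_const, ← sq]
    have : ∫ ω, centredAdj W x (G ω) i j * centredAdj W x (G ω) i j ∂P ≤ ∫ _, 1 ∂P := by
      refine integral_mono (hint j j) (integrable_const _) fun ω => ?_
      have := abs_centredAdj_le (x := x) hW (G ω) i j
      rw [abs_le] at this
      dsimp only
      nlinarith
    simp at this
    nlinarith [sq_nonneg (a j)]
  · intro k _ hk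
    rw [integral_mul_const, hG.integral_centredAdj_mul hW hk.symm, zero_mul]
  · simp

end Noise

/-! ### The nonlocal operator: noise estimate at a fixed state and Lipschitz dependence on the
state. -/

/-- The nonlocal operator with a kernel that is constant on products of cells. -/
noncomputable def nonlocalOp {n : ℕ} [NeZero n] (K : Fin n → Fin n → ℝ) (D : ℝ → ℝ) (f : I → ℝ)
    (x : I) : ℝ :=
  ∫ y, K (cellIdx n x) (cellIdx n y) * D (f y - f x)

theorem eLpNorm_two_sq {α : Type*} [MeasurableSpace α] {μ : Measure α} (f : α → ℝ) :
    eLpNorm f 2 μ ^ 2 = ∫⁻ x, ‖f x‖ₑ ^ 2 ∂μ := by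
  rw [eLpNorm_eq_lintegral_rpow_enorm_toReal (by norm_num) (by norm_num), ← ENNReal.rpow_natCast,
    ← ENNReal.rpow_mul]
  simp

section NonlocalOp

variable {n : ℕ} [NeZero n] {D : ℝ → ℝ} {f f' : I → ℝ} {K : Fin n → Fin n → ℝ}

theorem measurable_uncurry_comp_cellIdx (K : Fin n → Fin n → ℝ) :
    Measurable fun p : I × I => K (cellIdx n p.1) (cellIdx n p.2) :=
  (measurable_of_finite fun q : Fin n × Fin n => K q.1 q.2).comp
    ((measurable_cellIdx.comp measurable_fst).prodMk (measurable_cellIdx.comp measurable_snd))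

theorem measurable_comp_diff (hD : Continuous D) (hf : Measurable f) :
    Measurable fun p : I × I => D (f p.2 - f p.1) :=
  hD.measurable.comp ((hf.comp measurable_snd).sub (hf.comp measurable_fst))

theorem measurable_nonlocalOp (hD : Continuous D) (hf : Measurable f) :
    Measurable (nonlocalOp K D f) :=
  ((measurable_uncurry_comp_cellIdx K).mul
    (measurable_comp_diff hD hf)).stronglyMeasurable.integral_prod_right.measurable

theorem integrable_comp_diff (hD : Continuous D) (hf : Measurable f) {C : ℝ} {x : I}
    (hC : ∀ᵐ y, |D (f y - f x)| ≤ C) : Integrable fun y => D (f y - f x) :=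
  Integrable.of_bound (hD.measurable.comp (hf.sub_const _)).aestronglyMeasurable C hC

theorem integrable_nonlocalOp (hD : Continuous D) (hf : Measurable f) {C : ℝ} {x : I}
    (hC : ∀ᵐ y, |D (f y - f x)| ≤ C) :
    Integrable fun y => K (cellIdx n x) (cellIdx n y) * D (f y - f x) := by
  obtain ⟨B, hB⟩ := (Set.finite_range fun j => |K (cellIdx n x) j|).bddAbove
  exact (integrable_comp_diff hD hf hC).bdd_mul
    ((measurable_of_finite (K (cellIdx n x))).comp measurable_cellIdx).aestronglyMeasurable
    (ae_of_all _ fun y => hB ⟨_, rfl⟩)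

theorem nonlocalOp_eq_sum (hD : Continuous D) (hf : Measurable f) {C : ℝ} {x : I}
    (hC : ∀ᵐ y, |D (f y - f x)| ≤ C) :
    nonlocalOp K D f x = ∑ j, K (cellIdx n x) j * ∫ y in cell n j, D (f y - f x) := by
  have hint := integrable_comp_diff hD hf hC
  have e : (fun y => K (cellIdx n x) (cellIdx n y) * D (f y - f x)) = fun y =>
      ∑ j, K (cellIdx n x) j * (cell n j).indicator (fun y => D (f y - f x)) y := by
    ext y
    rw [Finset.sum_eq_single (cellIdx n y)]
    · rw [Set.indicator_of_mem (mem_cell_cellIdx y)]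
    · intro j _ hj
      rw [Set.indicator_of_notMem fun h => hj ((mem_cell_iff j y).1 h).symm, mul_zero]
    · simp
  rw [nonlocalOp, e, integral_finsetSum _ fun j _ =>
    (hint.indicator (measurableSet_cell j)).const_mul _]
  refine Finset.sum_congr rfl fun j _ => ?_
  rw [integral_const_mul, integral_indicator (measurableSet_cell j)]

theorem abs_setIntegral_cell_le {C : ℝ} {x : I} (hC : ∀ᵐ y, |D (f y - f x)| ≤ C) (j : Fin n) :
    |∫ y in cell n j, D (f y - f x)| ≤ C / n := by
  have := norm_setIntegral_le_of_norm_le_const_ae' (μ := volume) (s := cell n j) (C := C)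
    (f := fun y => D (f y - f x)) (by simp [volume_cell]) (hC.mono fun y hy _ => hy)
  rwa [measureReal_cell, ← div_eq_mul_inv] at this

variable {Ω : Type*} [MeasurableSpace Ω] {P : Measure Ω} {W : I → I → ℝ} {x : Fin n → I}
  {G : Ω → Digraph (Fin n)} [IsProbabilityMeasure P]

/-- The second moment of the nonlocal operator whose kernel is the centred adjacency matrix, and
the resulting tail estimate. -/
theorem IsWRandomGraph.measure_le_eLpNorm_nonlocalOp (hW : IsGraphon W)
    (hG : IsWRandomGraph P W x G) (hD : Continuous D) (hf : Measurable f) {C : ℝ}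
    (hC : ∀ᵐ x, ∀ᵐ y, |D (f y - f x)| ≤ C) {δ : ℝ} (hδ : 0 < δ) :
    P {ω | ENNReal.ofReal δ ≤ eLpNorm (nonlocalOp (centredAdj W x (G ω)) D f) 2 volume} ≤
      ENNReal.ofReal (C ^ 2 / n) / ENNReal.ofReal δ ^ 2 := by
  have hn : 0 < n := NeZero.pos n
  have hn' : (0 : ℝ) < n := by exact_mod_cast hn
  set a : Fin n → I → ℝ := fun j z => ∫ y in cell n j, D (f y - f z) with ha
  set Z : Ω → I → ℝ := fun ω z => ∑ j, centredAdj W x (G ω) (cellIdx n z) j * a j z with hZ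
  have ha_meas : ∀ j, Measurable (a j) := fun j =>
    (measurable_comp_diff hD hf).stronglyMeasurable.integral_prod_right.measurable
  have hK_meas : ∀ j, Measurable fun p : Ω × I => centredAdj W x (G p.1) (cellIdx n p.2) j := by
    intro j
    have h : Measurable fun q : Ω × Fin n => centredAdj W x (G q.1) q.2 j :=
      measurable_from_prod_countable_left fun i => hG.measurable_centredAdj i j
    exact h.comp (measurable_fst.prodMk (measurable_cellIdx.comp measurable_snd))
  have hZ_meas : Measurable (Function.uncurry Z) :=
    Finset.measurable_sum _ fun j _ => (hK_meas j).mul ((ha_meas j).comp measurable_snd)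
  have hZ2_meas : Measurable (Function.uncurry fun ω z => ‖Z ω z‖ₑ ^ 2) :=
    hZ_meas.enorm.pow_const 2
  have hZ_eq : ∀ ω, eLpNorm (nonlocalOp (centredAdj W x (G ω)) D f) 2 volume ^ 2 =
      ∫⁻ z, ‖Z ω z‖ₑ ^ 2 := by
    intro ω
    rw [eLpNorm_two_sq]
    refine lintegral_congr_ae ?_
    filter_upwards [hC] with z hz
    rw [nonlocalOp_eq_sum hD hf hz]
  have hmoment : ∫⁻ ω, (∫⁻ z, ‖Z ω z‖ₑ ^ 2) ∂P ≤ ENNReal.ofReal (C ^ 2 / n) := by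
    -- Tonelli: for fixed z only the row of the cell of z enters, with deterministic weights `a j
    -- z`.
    rw [lintegral_lintegral_swap hZ2_meas.aemeasurable]
    calc ∫⁻ z, ∫⁻ ω, ‖Z ω z‖ₑ ^ 2 ∂P ≤ ∫⁻ _ : I, ENNReal.ofReal (C ^ 2 / n) := by
          refine lintegral_mono_ae ?_
          filter_upwards [hC] with z hz
          have hb : ∀ ω, |Z ω z| ≤ ∑ j, |a j z| := fun ω =>
            (Finset.abs_sum_le_sum_abs _ _).trans (Finset.sum_le_sum fun j _ => by
              rw [abs_mul]
              exact mul_le_of_le_one_left (abs_nonneg _) (abs_centredAdj_le hW _ _ _))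
          have hm : Measurable fun ω => Z ω z := hZ_meas.comp measurable_prodMk_right
          have hint : Integrable (fun ω => Z ω z ^ 2) P := by
            refine Integrable.of_bound (hm.pow_const 2).aestronglyMeasurable
              ((∑ j, |a j z|) ^ 2) (ae_of_all _ fun ω => ?_)
            rw [norm_pow]
            exact pow_le_pow_left₀ (norm_nonneg _) (hb ω) 2
          have e : ∀ ω, ‖Z ω z‖ₑ ^ 2 = ENNReal.ofReal (Z ω z ^ 2) := fun ω => by
            rw [← sq_abs, ENNReal.ofReal_pow (abs_nonneg _), ← Real.norm_eq_abs, ofReal_norm]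
          simp_rw [e]
          rw [← ofReal_integral_eq_lintegral_ofReal hint (ae_of_all _ fun ω => sq_nonneg _)]
          refine ENNReal.ofReal_le_ofReal ((hG.integral_sq_sum_le hW _ _).trans ?_)
          -- There are n weights, each at most C/n in absolute value.
          calc ∑ j, a j z ^ 2 ≤ ∑ _j : Fin n, (C / n) ^ 2 := Finset.sum_le_sum fun j _ => by
                rw [← sq_abs]
                exact pow_le_pow_left₀ (abs_nonneg _) (abs_setIntegral_cell_le hz j) 2
            _ = C ^ 2 / n := by simp; field_simp
      _ = ENNReal.ofReal (C ^ 2 / n) := by simp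
  have hδ0 : ENNReal.ofReal δ ^ 2 ≠ 0 := by positivity
  have hδt : ENNReal.ofReal δ ^ 2 ≠ ∞ := by simp
  calc P {ω | ENNReal.ofReal δ ≤ eLpNorm (nonlocalOp (centredAdj W x (G ω)) D f) 2 volume}
      ≤ P {ω | ENNReal.ofReal δ ^ 2 ≤ ∫⁻ z, ‖Z ω z‖ₑ ^ 2} := by
        refine measure_mono fun ω hω => ?_
        simp only [Set.mem_ofPred_eq] at hω ⊢
        rw [← hZ_eq]
        exact pow_le_pow_left₀ zero_le hω 2
    _ ≤ (∫⁻ ω, (∫⁻ z, ‖Z ω z‖ₑ ^ 2) ∂P) / ENNReal.ofReal δ ^ 2 :=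
        meas_ge_le_lintegral_div hZ2_meas.lintegral_prod_right.aemeasurable hδ0 hδt
    _ ≤ _ := by gcongr

/-- The nonlocal operator is Lipschitz in the state, in the supremum norm. -/
theorem eLpNorm_nonlocalOp_le {L : NNReal} (hD : LipschitzWith L D) (hf : Measurable f)
    (hf' : Measurable f') (hK : ∀ i j, |K i j| ≤ 1) {C ρ : ℝ}
    (hC : ∀ᵐ x, ∀ᵐ y, |D (f y - f x)| ≤ C) (hC' : ∀ᵐ x, ∀ᵐ y, |D (f' y - f' x)| ≤ C)
    (hρ : ∀ᵐ x, |f x - f' x| ≤ ρ) :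
    eLpNorm (nonlocalOp K D f) 2 volume ≤
      eLpNorm (nonlocalOp K D f') 2 volume + ENNReal.ofReal (L * (ρ + ρ)) := by
  have hm := measurable_nonlocalOp (K := K) hD.continuous hf
  have hm' := measurable_nonlocalOp (K := K) hD.continuous hf'
  have hρ0 : 0 ≤ ρ := by
    obtain ⟨x, hx⟩ := hρ.exists
    exact (abs_nonneg _).trans hx
  have hdiff : eLpNorm (nonlocalOp K D f - nonlocalOp K D f') 2 volume ≤
      ENNReal.ofReal (L * (ρ + ρ)) := by
    have := eLpNorm_le_of_ae_bound (μ := volume) (p := 2)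
      (f := nonlocalOp K D f - nonlocalOp K D f') (C := L * (ρ + ρ)) (by
        filter_upwards [hC, hC', hρ] with x hx hx' hxρ
        rw [Pi.sub_apply, nonlocalOp, nonlocalOp, ← integral_sub
          (integrable_nonlocalOp hD.continuous hf hx) (integrable_nonlocalOp hD.continuous hf' hx')]
        have := norm_integral_le_of_norm_le_const (μ := volume) (C := L * (ρ + ρ))
          (f := fun y => K (cellIdx n x) (cellIdx n y) * D (f y - f x) -
            K (cellIdx n x) (cellIdx n y) * D (f' y - f' x)) (by
          filter_upwards [hρ] with y hy
          rw [← mul_sub, norm_mul]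
          refine (mul_le_of_le_one_left (norm_nonneg _) (hK _ _)).trans ?_
          rw [← dist_eq_norm]
          refine (hD.dist_le_mul _ _).trans ?_
          gcongr
          rw [Real.dist_eq]
          calc |f y - f x - (f' y - f' x)| = |(f y - f' y) - (f x - f' x)| := by ring_nf
            _ ≤ |f y - f' y| + |f x - f' x| := abs_sub _ _
            _ ≤ ρ + ρ := add_le_add hy hxρ)
        simpa using this)
    simpa using this
  calc eLpNorm (nonlocalOp K D f) 2 volume
      = eLpNorm (nonlocalOp K D f' + (nonlocalOp K D f - nonlocalOp K D f')) 2 volume := by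
        rw [add_sub_cancel]
    _ ≤ _ := (eLpNorm_add_le hm'.aestronglyMeasurable (hm.sub hm').aestronglyMeasurable
        (by norm_num)).trans (by gcongr)

end NonlocalOp

/-! ### Comparison of the discrete and continuum velocity fields. -/

/-- The averaged discrepancy between a graphon and its sampled step kernel. -/
noncomputable def kernelError (W : I → I → ℝ) {n : ℕ} [NeZero n] (X : Fin n → I) (x : I) : ℝ :=
  ∫ y, |W (X (cellIdx n x)) (X (cellIdx n y)) - W x y|

theorem ae_abs_le_norm (f : Lp ℝ ∞ (volume : Measure I)) : ∀ᵐ x, |f x| ≤ ‖f‖ := by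
  have h := ae_le_lpNorm_exponent_top (Lp.memLp f)
  rw [← toReal_eLpNorm (Lp.aestronglyMeasurable f), ← Lp.norm_def] at h
  exact h

/-- `D` may be unbounded, but only its values on [-2M, 2M] are ever used. -/
theorem abs_lipschitz_diff_le {D : ℝ → ℝ} {L : NNReal} (hD : LipschitzWith L D) {a b M : ℝ}
    (ha : |a| ≤ M) (hb : |b| ≤ M) : |D (a - b)| ≤ |D 0| + L * (M + M) := by
  have h1 : |D (a - b) - D 0| ≤ L * |a - b| := by
    simpa [Real.dist_eq] using hD.dist_le_mul (a - b) 0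
  have h2 : |a - b| ≤ M + M := (abs_sub _ _).trans (add_le_add ha hb)
  have h3 : |D (a - b)| ≤ |D (a - b) - D 0| + |D 0| := by
    simpa using abs_add_le (D (a - b) - D 0) (D 0)
  have h4 : L * |a - b| ≤ L * (M + M) := by gcongr
  linarith

theorem ae_ae_abs_lipschitz_diff_le {D : ℝ → ℝ} {L : NNReal} (hD : LipschitzWith L D)
    {f : I → ℝ} {M : ℝ} (hf : ∀ᵐ x, |f x| ≤ M) :
    ∀ᵐ x, ∀ᵐ y, |D (f y - f x)| ≤ |D 0| + L * (M + M) := by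
  filter_upwards [hf] with x hx
  filter_upwards [hf] with y hy
  exact abs_lipschitz_diff_le hD hy hx

/-- The `L²` estimate that follows from a pointwise bound of the kind produced by a Lipschitz
nonlocal term and two perturbations. -/
theorem eLpNorm_le_of_abs_le {α : Type*} [MeasurableSpace α] {μ : Measure α}
    [IsProbabilityMeasure μ] {F e k z : α → ℝ} (he : AEStronglyMeasurable e μ)
    (hk : AEStronglyMeasurable k μ) (hz : AEStronglyMeasurable z μ) {L C : ℝ} (hL : 0 ≤ L)
    (hC : 0 ≤ C)
    (hF : ∀ᵐ x ∂μ, |F x| ≤ L * (∫ y, |e y| ∂μ) + L * |e x| + C * k x + |z x|) :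
    eLpNorm F 2 μ ≤ ENNReal.ofReal L * eLpNorm e 2 μ + ENNReal.ofReal L * eLpNorm e 2 μ +
      ENNReal.ofReal C * eLpNorm k 2 μ + eLpNorm z 2 μ := by
  -- On a probability space the `L¹` norm is at most the `L²` norm. If e is not integrable, the
  -- Bochner integral is 0 and the bound is trivial.
  have hcle : ENNReal.ofReal (∫ y, |e y| ∂μ) ≤ eLpNorm e 2 μ := by
    refine le_trans ?_ (eLpNorm_le_eLpNorm_of_exponent_le (p := 1) (by norm_num) he)
    rw [eLpNorm_one_eq_lintegral_enorm]
    by_cases hi : Integrable e μ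
    · rw [ofReal_integral_eq_lintegral_ofReal hi.abs (ae_of_all _ fun _ => abs_nonneg _)]
      refine lintegral_mono fun x => ?_
      rw [← Real.norm_eq_abs, ofReal_norm]
    · have : ¬ Integrable (fun y => |e y|) μ := fun h => hi ((integrable_norm_iff he).1 h)
      rw [integral_undef this]
      simp
  have hc0 : 0 ≤ ∫ y, |e y| ∂μ := integral_nonneg fun _ => abs_nonneg _
  generalize (∫ y, |e y| ∂μ) = c at *
  have m1 : AEStronglyMeasurable (fun _ : α => L * c) μ := aestronglyMeasurable_const
  have m2 : AEStronglyMeasurable (L • fun x => |e x|) μ := he.norm.const_smul _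
  have m3 : AEStronglyMeasurable (C • k) μ := hk.const_smul _
  have m4 : AEStronglyMeasurable (fun x => |z x|) μ := hz.norm
  have n1 : eLpNorm (fun _ : α => L * c) 2 μ ≤ ENNReal.ofReal L * eLpNorm e 2 μ := by
    rw [eLpNorm_const' _ (by norm_num) (by norm_num)]
    simp only [measure_univ, ENNReal.one_rpow, mul_one]
    rw [← ofReal_norm, Real.norm_of_nonneg (by positivity), ENNReal.ofReal_mul hL]
    gcongr
  have n2 : eLpNorm (L • fun x => |e x|) 2 μ = ENNReal.ofReal L * eLpNorm e 2 μ := by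
    have h2 : eLpNorm (fun x => |e x|) 2 μ = eLpNorm e 2 μ := eLpNorm_norm e
    rw [eLpNorm_const_smul, h2, ← ofReal_norm, Real.norm_of_nonneg hL]
  have n3 : eLpNorm (C • k) 2 μ = ENNReal.ofReal C * eLpNorm k 2 μ := by
    rw [eLpNorm_const_smul, ← ofReal_norm, Real.norm_of_nonneg hC]
  have n4 : eLpNorm (fun x => |z x|) 2 μ = eLpNorm z 2 μ := eLpNorm_norm z
  have hmono : eLpNorm F 2 μ ≤
      eLpNorm ((((fun _ => L * c) + L • fun x => |e x|) + C • k) + fun x => |z x|) 2 μ :=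
    eLpNorm_mono_ae_real hF
  refine hmono.trans ((eLpNorm_add_le ((m1.add m2).add m3) m4 (by norm_num)).trans ?_)
  refine add_le_add ((eLpNorm_add_le (m1.add m2) m3 (by norm_num)).trans ?_) n4.le
  exact add_le_add ((eLpNorm_add_le m1 m2 (by norm_num)).trans (add_le_add n1 n2.le)) n3.le

section Velocity

variable {W : I → I → ℝ} {n : ℕ} [NeZero n] {X : Fin n → I}

theorem aestronglyMeasurable_kernelDiff (hW : IsGraphon W) (X : Fin n → I) :
    AEStronglyMeasurable (fun p : I × I => W (X (cellIdx n p.1)) (X (cellIdx n p.2)) - W p.1 p.2)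
      (volume.prod volume) :=
  ((measurable_uncurry_comp_cellIdx fun i j => W (X i) (X j)).aestronglyMeasurable).sub
    hW.measurable.aestronglyMeasurable

theorem aestronglyMeasurable_kernelError (hW : IsGraphon W) (X : Fin n → I) :
    AEStronglyMeasurable (kernelError W X) volume :=
  AEStronglyMeasurable.integral_prod_right' (aestronglyMeasurable_kernelDiff hW X).norm

theorem abs_kernelDiff_le (hW : IsGraphon W) (a b c d : I) : |W a b - W c d| ≤ 1 := by
  have := hW.nonneg a b
  have := hW.le_one a b
  have := hW.nonneg c d
  have := hW.le_one c d
  rw [abs_le]; constructor <;> linarith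

theorem measurable_stepFun (w : Fin n → ℝ) : Measurable (stepFun w) := by
  have : stepFun w = fun x => w (cellIdx n x) := funext fun x => stepFun_apply w x
  rw [this]
  exact (measurable_of_finite w).comp measurable_cellIdx

/-- The velocity of the `i`-th node. -/
noncomputable def velocity (D : ℝ → ℝ) {n : ℕ} (G : Digraph (Fin n)) (w : Fin n → ℝ) (i : Fin n) :
    ℝ :=
  (n : ℝ)⁻¹ * ∑ j, adj G i j * D (w j - w i)

/-- Every cell has measure 1/n, so the average over nodes is an integral over I; this puts the
discrete system in the form of the continuum one. -/
theorem velocity_cellIdx (D : ℝ → ℝ) (G : Digraph (Fin n)) (w : Fin n → ℝ) (x : I) :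
    velocity D G w (cellIdx n x) = nonlocalOp (adj G) D (stepFun w) x := by
  simp only [nonlocalOp, stepFun_apply]
  exact (integral_comp_cellIdx fun j => adj G (cellIdx n x) j * D (w j - w (cellIdx n x))).symm

/-- Pointwise comparison of the discrete and the continuum velocity fields. -/
theorem abs_velocity_sub_le (hW : IsGraphon W) {D : ℝ → ℝ} {L : NNReal} (hD : LipschitzWith L D)
    {f : I → ℝ} (hf : Measurable f) {M C : ℝ} (hM : ∀ᵐ x, |f x| ≤ M)
    (hC : ∀ᵐ x, ∀ᵐ y, |D (f y - f x)| ≤ C) (G : Digraph (Fin n)) (w : Fin n → ℝ) :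
    ∀ᵐ x, |stepFun (velocity D G w) x - ∫ y, W x y * D (f y - f x)| ≤
      L * (∫ y, |stepFun w y - f y|) + L * |stepFun w x - f x| + C * kernelError W X x +
        |nonlocalOp (centredAdj W X G) D f x| := by
  have hWx : ∀ᵐ x : I, AEStronglyMeasurable
      (fun y => W (X (cellIdx n x)) (X (cellIdx n y)) - W x y) volume :=
    (aestronglyMeasurable_kernelDiff hW X).prodMk_left
  have hsf : Integrable fun y => |stepFun w y - f y| := by
    obtain ⟨B, hB⟩ := (Set.finite_range fun j => |w j|).bddAbove
    refine (Integrable.sub (Integrable.of_bound (measurable_stepFun w).aestronglyMeasurable B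
      (ae_of_all _ fun y => ?_)) (Integrable.of_bound hf.aestronglyMeasurable M hM)).abs
    rw [stepFun_apply]
    exact hB ⟨_, rfl⟩
  filter_upwards [hC, hWx] with x hx hWx
  have hfD := integrable_comp_diff hD.continuous hf hx
  have hint1 : Integrable fun y =>
      adj G (cellIdx n x) (cellIdx n y) * D (stepFun w y - stepFun w x) := by
    obtain ⟨B, hB⟩ := (Set.finite_range fun j =>
      |adj G (cellIdx n x) j * D (w j - w (cellIdx n x))|).bddAbove
    simp only [stepFun_apply]
    exact Integrable.of_bound ((measurable_of_finite fun j =>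
      adj G (cellIdx n x) j * D (w j - w (cellIdx n x))).comp
        measurable_cellIdx).aestronglyMeasurable B (ae_of_all _ fun y => hB ⟨_, rfl⟩)
  have hint2 : Integrable fun y => adj G (cellIdx n x) (cellIdx n y) * D (f y - f x) :=
    integrable_nonlocalOp hD.continuous hf hx
  have hint3 : Integrable fun y =>
      centredAdj W X G (cellIdx n x) (cellIdx n y) * D (f y - f x) :=
    integrable_nonlocalOp hD.continuous hf hx
  have hint4 : Integrable fun y =>
      (W (X (cellIdx n x)) (X (cellIdx n y)) - W x y) * D (f y - f x) :=
    hfD.bdd_mul hWx (ae_of_all _ fun y => abs_kernelDiff_le hW _ _ _ _)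
  have hint5 : Integrable fun y => |W (X (cellIdx n x)) (X (cellIdx n y)) - W x y| :=
    Integrable.of_bound hWx.norm 1 (ae_of_all _ fun y => by
      rw [Real.norm_eq_abs, abs_abs]; exact abs_kernelDiff_le hW _ _ _ _)
  -- Write W as adjacency minus centred adjacency minus (sampled W - W).
  have hWeq : ∫ y, W x y * D (f y - f x) =
      ∫ y, (adj G (cellIdx n x) (cellIdx n y) * D (f y - f x) -
        centredAdj W X G (cellIdx n x) (cellIdx n y) * D (f y - f x) -
        (W (X (cellIdx n x)) (X (cellIdx n y)) - W x y) * D (f y - f x)) := by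
    refine integral_congr_ae (ae_of_all _ fun y => ?_)
    simp only [centredAdj]
    ring
  have hint23 : Integrable fun y => adj G (cellIdx n x) (cellIdx n y) * D (f y - f x) -
        centredAdj W X G (cellIdx n x) (cellIdx n y) * D (f y - f x) := hint2.sub hint3
  rw [integral_sub hint23 hint4, integral_sub hint2 hint3] at hWeq
  have hsplit : stepFun (velocity D G w) x - ∫ y, W x y * D (f y - f x) =
      (∫ y, (adj G (cellIdx n x) (cellIdx n y) * D (stepFun w y - stepFun w x) -
        adj G (cellIdx n x) (cellIdx n y) * D (f y - f x))) +
      (∫ y, (W (X (cellIdx n x)) (X (cellIdx n y)) - W x y) * D (f y - f x)) +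
      nonlocalOp (centredAdj W X G) D f x := by
    rw [integral_sub hint1 hint2, hWeq, stepFun_apply, velocity_cellIdx]
    simp only [nonlocalOp]
    ring
  -- Entries of the adjacency matrix lie in [0,1], so this bound is uniform over all graphs.
  have b1 : |∫ y, (adj G (cellIdx n x) (cellIdx n y) * D (stepFun w y - stepFun w x) -
        adj G (cellIdx n x) (cellIdx n y) * D (f y - f x))| ≤
      L * (∫ y, |stepFun w y - f y|) + L * |stepFun w x - f x| := by
    have : ∫ y, (L * |stepFun w y - f y| + L * |stepFun w x - f x|) =
        L * (∫ y, |stepFun w y - f y|) + L * |stepFun w x - f x| := by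
      rw [integral_add (hsf.const_mul _) (integrable_const _), integral_const_mul]
      simp
    rw [← this]
    refine (Real.norm_eq_abs _).symm.trans_le (norm_integral_le_of_norm_le
      ((hsf.const_mul _).add (integrable_const _)) (ae_of_all _ fun y => ?_))
    rw [← mul_sub, norm_mul, Real.norm_eq_abs, abs_of_nonneg (adj_nonneg _ _ _)]
    refine (mul_le_of_le_one_left (norm_nonneg _) (adj_le_one _ _ _)).trans ?_
    rw [← dist_eq_norm, ← mul_add]
    refine (hD.dist_le_mul _ _).trans ?_
    gcongr
    rw [Real.dist_eq]
    calc |stepFun w y - stepFun w x - (f y - f x)|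
        = |(stepFun w y - f y) - (stepFun w x - f x)| := by ring_nf
      _ ≤ _ := abs_sub _ _
  have b2 : |∫ y, (W (X (cellIdx n x)) (X (cellIdx n y)) - W x y) * D (f y - f x)| ≤
      C * kernelError W X x := by
    rw [kernelError, ← integral_const_mul]
    refine (Real.norm_eq_abs _).symm.trans_le
      (norm_integral_le_of_norm_le (hint5.const_mul _) ?_)
    filter_upwards [hx] with y hy
    rw [norm_mul, mul_comm]
    exact mul_le_mul_of_nonneg_right hy (norm_nonneg _)
  rw [hsplit]
  exact (abs_add_le _ _).trans (add_le_add ((abs_add_le _ _).trans (add_le_add b1 b2)) le_rfl)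

theorem eLpNorm_velocity_sub_le (hW : IsGraphon W) {D : ℝ → ℝ} {L : NNReal}
    (hD : LipschitzWith L D) {f : I → ℝ} (hf : Measurable f) {M C : ℝ} (hM : ∀ᵐ x, |f x| ≤ M)
    (hC : ∀ᵐ x, ∀ᵐ y, |D (f y - f x)| ≤ C) (G : Digraph (Fin n)) (w : Fin n → ℝ) :
    eLpNorm (fun x => stepFun (velocity D G w) x - ∫ y, W x y * D (f y - f x)) 2 volume ≤
      ENNReal.ofReal L * eLpNorm (fun x => stepFun w x - f x) 2 volume +
      ENNReal.ofReal L * eLpNorm (fun x => stepFun w x - f x) 2 volume +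
      ENNReal.ofReal C * eLpNorm (kernelError W X) 2 volume +
      eLpNorm (nonlocalOp (centredAdj W X G) D f) 2 volume := by
  set F : I → ℝ := fun x => stepFun (velocity D G w) x - ∫ y, W x y * D (f y - f x)
  have hF := abs_velocity_sub_le (X := X) hW hD hf hM hC G w
  have hZm : AEStronglyMeasurable (nonlocalOp (centredAdj W X G) D f) volume :=
    (measurable_nonlocalOp hD.continuous hf).aestronglyMeasurable
  have hem : AEStronglyMeasurable (fun x => stepFun w x - f x) volume :=
    ((measurable_stepFun w).sub hf).aestronglyMeasurable
  have hC0 : 0 ≤ C := by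
    obtain ⟨x, hx⟩ := hC.exists
    obtain ⟨y, hy⟩ := hx.exists
    exact (abs_nonneg _).trans hy
  exact eLpNorm_le_of_abs_le hem (aestronglyMeasurable_kernelError hW X) hZm L.2 hC0 hF

end Velocity

/-! ### Differentiation in `L²(I)` and the Gronwall estimate. -/

/-- The inclusion of `L^∞(I)` into `L²(I)`. -/
noncomputable def lpTopToTwo : Lp ℝ ∞ (volume : Measure I) →L[ℝ] Lp ℝ 2 (volume : Measure I) :=
  LinearMap.mkContinuous
    { toFun := fun f => ⟨f.1, Lp.antitone le_top f.2⟩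
      map_add' := fun _ _ => rfl
      map_smul' := fun _ _ => rfl } 1 fun f => by
    have h : ‖(⟨f.1, Lp.antitone le_top f.2⟩ : Lp ℝ 2 (volume : Measure I))‖ =
        (eLpNorm f 2 volume).toReal := rfl
    rw [one_mul, Lp.norm_def f]
    refine h.trans_le (ENNReal.toReal_mono (Lp.eLpNorm_ne_top f) ?_)
    exact eLpNorm_le_eLpNorm_of_exponent_le le_top (Lp.aestronglyMeasurable f)

theorem coeFn_lpTopToTwo (f : Lp ℝ ∞ (volume : Measure I)) :
    (lpTopToTwo f : I → ℝ) = f := rfl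

section Step

variable {n : ℕ} [NeZero n]

theorem memLp_stepFun (v : Fin n → ℝ) : MemLp (stepFun v) 2 volume := by
  obtain ⟨B, hB⟩ := (Set.finite_range fun j => |v j|).bddAbove
  refine MemLp.of_bound (measurable_stepFun v).aestronglyMeasurable B (ae_of_all _ fun y => ?_)
  rw [stepFun_apply]
  exact hB ⟨_, rfl⟩

/-- Step functions as a linear map into `L²(I)`. -/
noncomputable def stepLp (n : ℕ) [NeZero n] : (Fin n → ℝ) →ₗ[ℝ] Lp ℝ 2 (volume : Measure I) where
  toFun v := (memLp_stepFun v).toLp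
  map_add' v w := by
    rw [← MemLp.toLp_add]
    congr 1
    ext x
    simp [stepFun_apply]
  map_smul' c v := by
    rw [RingHom.id_apply, ← MemLp.toLp_const_smul]
    congr 1
    ext x
    simp [stepFun_apply]

theorem coeFn_stepLp (v : Fin n → ℝ) : stepLp n v =ᵐ[volume] stepFun v :=
  (memLp_stepFun v).coeFn_toLp

theorem hasDerivAt_stepLp {v : ℝ → Fin n → ℝ} {v' : Fin n → ℝ} {t : ℝ} (h : HasDerivAt v v' t) :
    HasDerivAt (fun s => stepLp n (v s)) (stepLp n v') t :=
  (LinearMap.toContinuousLinearMap (stepLp n)).hasFDerivAt.comp_hasDerivAt t h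

end Step

theorem IsDiscreteSolution.hasDerivAt_velocity {D : ℝ → ℝ} {g : I → ℝ} {n : ℕ} {X : Fin n → I}
    {G : Digraph (Fin n)} {v : ℝ → Fin n → ℝ} (hv : IsDiscreteSolution D g X G v) (t : ℝ) :
    HasDerivAt v (velocity D G (v t)) t := by
  rw [hasDerivAt_pi]
  intro i
  refine (hv.hasDerivAt t i).congr_deriv ?_
  simp only [velocity, adj, ite_mul, one_mul, zero_mul, Finset.sum_filter]

/-- K ≥ 1 allows ε / K to be replaced by ε; the rate L + L + 1 in the stability estimate is chosen
for this and also covers L = 0. -/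
theorem gronwallBound_le {δ ε K x : ℝ} (hK : 1 ≤ K) (hε : 0 ≤ ε) :
    gronwallBound δ K ε x ≤ (δ + ε) * Real.exp (K * x) := by
  rw [gronwallBound_of_K_ne_0 (by linarith)]
  have h1 : ε / K ≤ ε := div_le_self hε hK
  have h2 : 0 ≤ ε / K := by positivity
  have h3 := Real.exp_pos (K * x)
  nlinarith

/-- Stability: a discrete solution stays close to the continuum solution, in terms of the initial
error, the kernel error and the noise along the continuum solution. -/
theorem normCL2_le {W : I → I → ℝ} (hW : IsGraphon W) {D : ℝ → ℝ} {L : NNReal}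
    (hD : LipschitzWith L D) {g : I → ℝ} {u : ℝ → Lp ℝ ∞ (volume : Measure I)}
    (hu : IsContinuumSolution W D g u) {T M : ℝ} (hM : ∀ t ∈ Set.Icc 0 T, ‖u t‖ ≤ M)
    {n : ℕ} [NeZero n] {X : Fin n → I} {G : Digraph (Fin n)} {v : ℝ → Fin n → ℝ}
    (hv : IsDiscreteSolution D g X G v) {δ κ ζ : ℝ} (hδ0 : 0 ≤ δ) (hκ0 : 0 ≤ κ) (hζ0 : 0 ≤ ζ)
    (hδ : eLpNorm (fun y => g (X (cellIdx n y)) - g y) 2 volume ≤ ENNReal.ofReal δ)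
    (hκ : ENNReal.ofReal (|D 0| + L * (M + M)) * eLpNorm (kernelError W X) 2 volume ≤
      ENNReal.ofReal κ)
    (hζ : ∀ t ∈ Set.Icc 0 T,
      eLpNorm (nonlocalOp (centredAdj W X G) D (u t)) 2 volume ≤ ENNReal.ofReal ζ) :
    normCL2 T (fun t y => stepFun (v t) y - u t y) ≤
      ENNReal.ofReal ((δ + (κ + ζ)) * Real.exp ((L + L + 1) * T)) := by
  set e : ℝ → Lp ℝ 2 (volume : Measure I) := fun t => stepLp n (v t) - lpTopToTwo (u t) with he
  set e' : ℝ → Lp ℝ 2 (volume : Measure I) := fun t =>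
    stepLp n (velocity D G (v t)) - lpTopToTwo (deriv u t) with he'
  -- Both terms of e are images of differentiable curves under continuous linear maps into `L²(I)`.
  have hderiv : ∀ t, HasDerivAt e (e' t) t := fun t =>
    (hasDerivAt_stepLp (hv.hasDerivAt_velocity t)).sub
      (lpTopToTwo.hasFDerivAt.comp_hasDerivAt t
        ((hu.contDiff.differentiable (by norm_num)) t).hasDerivAt)
  have hnorm : ∀ t, eLpNorm (fun y => stepFun (v t) y - u t y) 2 volume =
      ENNReal.ofReal ‖e t‖ := by
    intro t
    rw [Lp.norm_def, ENNReal.ofReal_toReal (Lp.eLpNorm_ne_top _)]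
    refine eLpNorm_congr_ae ?_
    filter_upwards [Lp.coeFn_sub (stepLp n (v t)) (lpTopToTwo (u t)), coeFn_stepLp (v t)]
      with y h1 h2
    rw [he, h1, Pi.sub_apply, h2, coeFn_lpTopToTwo]
  have h0 : ‖e 0‖ ≤ δ := by
    rw [← ENNReal.ofReal_le_ofReal_iff hδ0, ← hnorm]
    refine le_trans (eLpNorm_congr_ae ?_).le hδ
    filter_upwards [hu.init] with y hy
    rw [hy, stepFun_apply, hv.init]
  have hbound : ∀ t ∈ Set.Ico 0 T, ‖e' t‖ ≤ (L + L + 1) * ‖e t‖ + (κ + ζ) := by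
    intro t ht
    have ht' : t ∈ Set.Icc 0 T := Set.Ico_subset_Icc_self ht
    have hae : ∀ᵐ x, |u t x| ≤ M := (ae_abs_le_norm (u t)).mono fun x hx => hx.trans (hM t ht')
    have key := eLpNorm_velocity_sub_le (X := X) hW hD (Lp.stronglyMeasurable (u t)).measurable hae
      (ae_ae_abs_lipschitz_diff_le hD hae) G (v t)
    have hE' : ENNReal.ofReal ‖e' t‖ = eLpNorm (fun x => stepFun (velocity D G (v t)) x -
        ∫ y, W x y * D (u t y - u t x)) 2 volume := by
      rw [Lp.norm_def, ENNReal.ofReal_toReal (Lp.eLpNorm_ne_top _)]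
      refine eLpNorm_congr_ae ?_
      filter_upwards [Lp.coeFn_sub (stepLp n (velocity D G (v t))) (lpTopToTwo (deriv u t)),
        coeFn_stepLp (velocity D G (v t)), hu.deriv_eq t] with y h1 h2 h3
      rw [he', h1, Pi.sub_apply, h2, coeFn_lpTopToTwo, h3]
    rw [← hE', hnorm] at key
    have key2 := key.trans (add_le_add (add_le_add le_rfl hκ) (hζ t ht'))
    rw [← ENNReal.ofReal_mul NNReal.zero_le_coe, ← ENNReal.ofReal_add (by positivity) (by positivity),
      ← ENNReal.ofReal_add (by positivity) hκ0, ← ENNReal.ofReal_add (by positivity) hζ0,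
      ENNReal.ofReal_le_ofReal_iff (by positivity)] at key2
    have := norm_nonneg (e t)
    linarith
  have hgron := norm_le_gronwallBound_of_norm_deriv_right_le (a := 0) (b := T)
    (fun t _ => (hderiv t).continuousAt.continuousWithinAt)
    (fun t _ => (hderiv t).hasDerivWithinAt) h0 hbound
  refine iSup₂_le fun t ht => ?_
  rw [hnorm]
  refine ENNReal.ofReal_le_ofReal ((hgron t ht).trans ?_)
  have hL : (0 : ℝ) ≤ L := L.2
  refine (gronwallBound_le (by linarith) (by linarith)).trans ?_
  rw [sub_zero]
  gcongr
  exact ht.2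

/-! ### Vanishing of the initial, kernel and noise errors. -/

theorem tendsto_eLpNorm_two_of_bounded {F : ℕ → I → ℝ} {B : ℝ}
    (hm : ∀ n, AEStronglyMeasurable (F n) volume) (hB : ∀ n x, |F n x| ≤ B)
    (hlim : ∀ᵐ x, Tendsto (fun n => F n x) atTop (𝓝 0)) :
    Tendsto (fun n => eLpNorm (F n) 2 volume) atTop (𝓝 0) := by
  have h : Tendsto (fun n => ∫⁻ x, ‖F n x‖ₑ ^ (2 : ℝ)) atTop (𝓝 (∫⁻ _ : I, 0)) := by
    refine tendsto_lintegral_of_dominated_convergence' (fun _ => ENNReal.ofReal B ^ (2 : ℝ))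
      (fun n => (hm n).enorm.pow_const _) (fun n => ae_of_all _ fun x => ?_) (by simp) ?_
    · dsimp only
      rw [← ofReal_norm]
      gcongr
      exact hB n x
    · filter_upwards [hlim] with x hx
      have := (ENNReal.continuous_rpow_const (y := 2)).tendsto _ |>.comp hx.enorm
      simpa [Function.comp_def] using this
  have h2 := (ENNReal.continuous_rpow_const (y := 1 / 2)).tendsto _ |>.comp h
  simp only [lintegral_zero] at h2
  rw [ENNReal.zero_rpow_of_pos (by norm_num)] at h2
  refine h2.congr fun n => ?_
  rw [eLpNorm_eq_lintegral_rpow_enorm_toReal (by norm_num) (by norm_num)]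
  simp

theorem tendsto_eLpNorm_initialError {g : I → ℝ} (hgm : AEMeasurable g volume)
    (hgb : ∃ C : ℝ, ∀ x, |g x| ≤ C) (hgc : ∀ᵐ x : I, ContinuousAt g x)
    {x : (n : ℕ) → Fin n → I} (hx : ∀ n i, x n i ∈ closure (cell n i)) :
    Tendsto (fun n => eLpNorm (fun y => g (x (n + 1) (cellIdx (n + 1) y)) - g y) 2 volume) atTop
      (𝓝 0) := by
  obtain ⟨C, hC⟩ := hgb
  refine tendsto_eLpNorm_two_of_bounded (B := C + C) (fun n => ?_) (fun n y => ?_) ?_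
  · exact (((measurable_of_finite fun i => g (x (n + 1) i)).comp
      measurable_cellIdx).aestronglyMeasurable).sub hgm.aestronglyMeasurable
  · exact (abs_sub _ _).trans (add_le_add (hC _) (hC _))
  · filter_upwards [hgc] with y hy
    simpa using (hy.tendsto.comp (tendsto_sample hx y)).sub_const (g y)

/-- The sampled pair converges to (a, b), so the integrand tends to 0 wherever W is continuous. By
Fubini this holds for almost every b, for almost every a; dominated convergence is applied in b and
then in a. -/
theorem tendsto_eLpNorm_kernelError {W : I → I → ℝ} (hW : IsGraphon W)
    (hWc : ∀ᵐ p : I × I, ContinuousAt (fun q : I × I => W q.1 q.2) p)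
    {x : (n : ℕ) → Fin n → I} (hx : ∀ n i, x n i ∈ closure (cell n i)) :
    Tendsto (fun n => eLpNorm (kernelError W (x (n + 1))) 2 volume) atTop (𝓝 0) := by
  refine tendsto_eLpNorm_two_of_bounded (B := 1)
    (fun n => aestronglyMeasurable_kernelError hW _) (fun n a => ?_) ?_
  · have := norm_integral_le_of_norm_le_const (μ := (volume : Measure I)) (C := 1)
      (f := fun y => |W (x (n + 1) (cellIdx (n + 1) a)) (x (n + 1) (cellIdx (n + 1) y)) - W a y|)
      (ae_of_all _ fun y => by
        rw [Real.norm_eq_abs, abs_abs]; exact abs_kernelDiff_le hW _ _ _ _)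
    simpa [kernelError] using this
  · have hc : ∀ᵐ a : I, ∀ᵐ b : I, ContinuousAt (fun q : I × I => W q.1 q.2) (a, b) :=
      Measure.ae_ae_of_ae_prod hWc
    have hm : ∀ᵐ a : I, ∀ n : ℕ, AEStronglyMeasurable (fun y =>
        W (x (n + 1) (cellIdx (n + 1) a)) (x (n + 1) (cellIdx (n + 1) y)) - W a y) volume :=
      ae_all_iff.2 fun n => (aestronglyMeasurable_kernelDiff hW (x (n + 1))).prodMk_left
    filter_upwards [hc, hm] with a ha hma
    have := tendsto_integral_of_dominated_convergence (μ := (volume : Measure I))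
      (F := fun n y =>
        |W (x (n + 1) (cellIdx (n + 1) a)) (x (n + 1) (cellIdx (n + 1) y)) - W a y|)
      (f := fun _ => 0) (fun _ => 1) (fun n => (hma n).norm) (integrable_const _)
      (fun n => ae_of_all _ fun y => by
        rw [Real.norm_eq_abs, abs_abs]; exact abs_kernelDiff_le hW _ _ _ _) (by
      filter_upwards [ha] with b hb
      have := (hb.tendsto.comp ((tendsto_sample hx a).prodMk_nhds (tendsto_sample hx b))).sub_const
        (W a b)
      simpa using this.abs)
    simpa [kernelError] using this

theorem IsWRandomGraph.tendsto_measure_le_eLpNorm_nonlocalOp {W : I → I → ℝ} (hW : IsGraphon W)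
    {x : (n : ℕ) → Fin n → I} {Ω : Type*} [MeasurableSpace Ω] {P : Measure Ω}
    [IsProbabilityMeasure P] {G : (n : ℕ) → Ω → Digraph (Fin n)}
    (hG : ∀ n, IsWRandomGraph P W (x n) (G n)) {D : ℝ → ℝ} (hD : Continuous D) {f : I → ℝ}
    (hf : Measurable f) {C : ℝ} (hC : ∀ᵐ x, ∀ᵐ y, |D (f y - f x)| ≤ C) {δ : ℝ} (hδ : 0 < δ) :
    Tendsto (fun n : ℕ => P {ω | ENNReal.ofReal δ ≤
      eLpNorm (nonlocalOp (centredAdj W (x (n + 1)) (G (n + 1) ω)) D f) 2 volume}) atTop (𝓝 0) := by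
  have hlim : Tendsto (fun n : ℕ => ENNReal.ofReal (C ^ 2 / ((n + 1 : ℕ) : ℝ)) /
      ENNReal.ofReal δ ^ 2) atTop (𝓝 0) := by
    have h1 : Tendsto (fun n : ℕ => C ^ 2 / ((n + 1 : ℕ) : ℝ)) atTop (𝓝 0) :=
      (tendsto_const_div_atTop_nhds_zero_nat (C ^ 2)).comp (tendsto_add_atTop_nat 1)
    have h2 := ENNReal.Tendsto.div_const (ENNReal.tendsto_ofReal h1)
      (b := ENNReal.ofReal δ ^ 2) (Or.inr (by positivity))
    simpa using h2
  exact tendsto_of_tendsto_of_tendsto_of_le_of_le tendsto_const_nhds hlim (fun _ => zero_le)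
    fun n => (hG (n + 1)).measure_le_eLpNorm_nonlocalOp hW hD hf hC hδ

end GraphonHeat

/-! ### Finite net of times and conclusion. -/

open GraphonHeat in
theorem mainTheorem2
    (W : I → I → ℝ) (hW : GraphonHeat.IsGraphon W)
    (hWc : ∀ᵐ p : I × I, ContinuousAt (fun q : I × I => W q.1 q.2) p)
    (D : ℝ → ℝ) (hD : ∃ L, LipschitzWith L D)
    (g : I → ℝ) (hgm : AEMeasurable g volume) (hgb : ∃ C : ℝ, ∀ x, |g x| ≤ C)
    (hgc : ∀ᵐ x : I, ContinuousAt g x)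
    (u : ℝ → Lp ℝ ∞ (volume : Measure I)) (hu : GraphonHeat.IsContinuumSolution W D g u)
    (T : ℝ) (hT : 0 < T)
    (hpos : ∀ t ∈ Set.Icc (0 : ℝ) T,
      0 < ∫ p : I × I, (D (u t p.2 - u t p.1)) ^ 2 * (W p.1 p.2 * (1 - W p.1 p.2)))
    (x : (n : ℕ) → Fin n → I) (hx : ∀ n i, x n i ∈ closure (GraphonHeat.cell n i))
    {Ω : Type*} [MeasurableSpace Ω] (P : Measure Ω) [IsProbabilityMeasure P]
    (G : (n : ℕ) → Ω → Digraph (Fin n))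
    (hG : ∀ n, GraphonHeat.IsWRandomGraph P W (x n) (G n))
    (v : (n : ℕ) → Ω → ℝ → Fin n → ℝ)
    (hv : ∀ n ω, GraphonHeat.IsDiscreteSolution D g (x n) (G n ω) (v n ω)) :
    ∀ ε : ℝ, 0 < ε →
      Tendsto
        (fun n : ℕ => P {ω | ENNReal.ofReal ε ≤
          GraphonHeat.normCL2 T (fun t y => GraphonHeat.stepFun (v n ω t) y - u t y)})
        atTop (𝓝 0) := by
  intro ε hε
  obtain ⟨L, hL⟩ := hD
  have hL0 : (0 : ℝ) ≤ L := L.2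
  have huc : Continuous u := hu.contDiff.continuous
  obtain ⟨M, hM⟩ := isCompact_Icc.exists_bound_of_continuousOn (s := Set.Icc 0 T) huc.continuousOn
  have hae : ∀ t ∈ Set.Icc 0 T, ∀ᵐ x, |u t x| ≤ M := fun t ht =>
    (ae_abs_le_norm (u t)).mono fun x hx => hx.trans (hM t ht)
  have hC := fun t ht => ae_ae_abs_lipschitz_diff_le hL (hae t ht)
  have hmeas : ∀ t, Measurable (u t) := fun t => (Lp.stronglyMeasurable (u t)).measurable
  set E := Real.exp ((L + L + 1) * T) with hE
  have hE0 : 0 < E := Real.exp_pos _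
  -- The initial, kernel and noise errors get η each, for a total of 3ηE = 3ε/4 < ε.
  set η := ε / (4 * E) with hη
  have hη0 : 0 < η := by positivity
  -- Mesh of the net in `L^∞`: moving the state by ρ changes the noise by at most 2Lρ ≤ η/2. The L +
  -- 1 avoids division by zero.
  set ρ := η / (4 * (L + 1)) with hρ
  have hρ0 : 0 < ρ := by positivity
  have hLρ : L * (ρ + ρ) ≤ η / 2 := by
    have : (L + 1) * (ρ + ρ) = η / 2 := by rw [hρ]; field_simp; norm_num
    nlinarith
  obtain ⟨S, hS, hcover⟩ := (isCompact_Icc (a := (0 : ℝ)) (b := T)).elim_nhds_subcover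
    (fun t => {s | ‖u s - u t‖ < ρ}) fun t _ =>
      (isOpen_lt (huc.sub continuous_const).norm continuous_const).mem_nhds (by simpa using hρ0)
  have hsum : Tendsto (fun n : ℕ => ∑ t ∈ S, P {ω | ENNReal.ofReal (η / 2) ≤
      eLpNorm (nonlocalOp (centredAdj W (x (n + 1)) (G (n + 1) ω)) D (u t)) 2 volume})
      atTop (𝓝 0) := by
    have := tendsto_finsetSum S fun t ht =>
      IsWRandomGraph.tendsto_measure_le_eLpNorm_nonlocalOp hW hG hL.continuous (hmeas t)
        (hC t (hS t ht)) (half_pos hη0)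
    simpa using this
  have hinit := (tendsto_eLpNorm_initialError hgm hgb hgc hx).eventually_le_const
    (ENNReal.ofReal_pos.2 hη0)
  have hkern : ∀ᶠ n : ℕ in atTop, ENNReal.ofReal (|D 0| + L * (M + M)) *
      eLpNorm (kernelError W (x (n + 1))) 2 volume ≤ ENNReal.ofReal η := by
    have h := ENNReal.Tendsto.const_mul (a := ENNReal.ofReal (|D 0| + L * (M + M)))
      (tendsto_eLpNorm_kernelError hW hWc hx) (Or.inr (by simp))
    rw [mul_zero] at h
    exact h.eventually_le_const (ENNReal.ofReal_pos.2 hη0)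
  -- The shift discards n = 0, where there are no cells.
  rw [← tendsto_add_atTop_iff_nat 1]
  refine tendsto_of_tendsto_of_tendsto_of_le_of_le' tendsto_const_nhds hsum
    (Eventually.of_forall fun _ => zero_le) ?_
  filter_upwards [hinit, hkern] with n hn1 hn2
  -- If the noise is below η/2 at every net time, the error is below ε. Monotonicity and
  -- subadditivity hold for arbitrary sets, so no measurability of the supremum in ω is needed.
  refine le_trans (measure_mono fun ω hω => ?_) (measure_biUnion_finset_le S _)
  by_contra hnot
  simp only [Set.mem_iUnion, Set.mem_ofPred_eq, not_exists, not_le] at hnot hω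
  have hζ : ∀ t ∈ Set.Icc 0 T, eLpNorm (nonlocalOp (centredAdj W (x (n + 1)) (G (n + 1) ω)) D
      (u t)) 2 volume ≤ ENNReal.ofReal η := by
    intro t ht
    obtain ⟨s, hs, hts⟩ := Set.mem_iUnion₂.1 (hcover ht)
    have hclose : ∀ᵐ y, |u t y - u s y| ≤ ρ := by
      filter_upwards [ae_abs_le_norm (u t - u s), Lp.coeFn_sub (u t) (u s)] with y h1 h2
      rw [h2, Pi.sub_apply] at h1
      exact h1.trans (le_of_lt hts)
    calc _ ≤ _ := eLpNorm_nonlocalOp_le hL (hmeas t) (hmeas s)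
          (fun i j => abs_centredAdj_le hW _ i j) (hC t ht) (hC s (hS s hs)) hclose
      _ ≤ ENNReal.ofReal (η / 2) + ENNReal.ofReal (η / 2) :=
        add_le_add (hnot s hs).le (ENNReal.ofReal_le_ofReal hLρ)
      _ = ENNReal.ofReal η := by
        rw [← ENNReal.ofReal_add (by positivity) (by positivity), add_halves]
  have hfin := hω.trans (normCL2_le hW hL hu hM (hv (n + 1) ω) hη0.le hη0.le hη0.le hn1 hn2 hζ)
  rw [ENNReal.ofReal_le_ofReal_iff (by positivity)] at hfin
  have : (η + (η + η)) * E = 3 / 4 * ε := by rw [hη]; field_simp; norm_num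
  rw [← hE] at hfin
  linarith
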